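/- **Setting.** All probability spaces are arbitrary. For $p\in[1,\infty)$ and a real random variable $X\in L^p$ put $\|X\|_p=(\mathbb E|X|^p)^{1/p}$ and, for $\lambda\in[0,1)$, $$\mathbb Q_p(X,\lambda)=\inf_{c\in\mathbb R}\Bigl(\tfrac1{1-\lambda}\|(X-c)_+\|_p+c\Bigr).$$ The essential supremum $\operatorname{ess\,sup}X$ may be $+\infty$. The buffered probability of $X$ at $x\in\mathbb R$ is $$\mathbb P_p(X,x)=\begin{cases}0,& x>\operatorname{ess\,sup}X,\\ \mathbb P(X=\operatorname{ess\,sup}X)^{1/p},& x=\operatorname{ess\,sup}X,\\ 1-\mathbb Q_p^{-1}(X,x),&\mathbb EX<x<\operatorname{ess\,sup}X,\\ 1,& x\le\mathbb EX,\end{cases}$$ where $\mathbb Q_p^{-1}(X,x)$ is the unique $\lambda\in[0,1)$ with $\mathbb Q_p(X,\lambda)=x$. (The values in the second and fourth cases agree when both apply.) A random variable $Z$ dominates $W$ in the second stochastic order, written $Z\succcurlyeq W$, if $\mathbb EU(Z)\ge\mathbb EU(W)$ for every increasing concave $U:\mathbb R\to\mathbb R$ for which both expectations exist (are finite). **Theorem.**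 1. Let $p\in[1,\infty)$ and $X\in L^p$. The function $x\mapsto\mathbb P_p(X,x)$ is non-increasing on $\mathbb R$, and it is continuous and strictly decreasing on $[\mathbb EX,\operatorname{ess\,sup}X)$. 2. Let $p\in[1,\infty)$ and $x\in\mathbb R$. The function $X\mapsto\mathbb P_p(X,x)$ on $L^p$ is * quasi-convex: $\{X\in L^p:\mathbb P_p(X,x)\le r\}$ is convex for every $r\in\mathbb R$; * law invariant: if $X,Y\in L^p$ (possibly on different probability spaces) have the same distribution, then $\mathbb P_p(X,x)=\mathbb P_p(Y,x)$; * monotone in the second order, $X$ and $Y$ being regarded as losses and hence $-X$ and $-Y$ as returns: if $X,Y\in L^p$ (possibly on different probability spaces) and $-X\succcurlyeq -Y$, then $\mathbb P_p(X,x)\le\mathbb P_p(Y,x)$; * continuous with respect to the $L^p$-norm at every $X\in L^p$, except those $X$ with $\operatorname{ess\,sup}X=x$ and $\mathbb P(X=x)>0$; * concave with respect to mixtures: if $X,X_1,X_2\in L^p$ (possibly on different probability spaces), $t\in[0,1]$ and the distribution of $X$ is $t$ times that of $X_1$ plus $1-t$ times that of $X_2$, then $\mathbb P_p(X,x)\ge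 t\,\mathbb P_p(X_1,x)+(1-t)\,\mathbb P_p(X_2,x)$. 3. For every random variable $X$ and $x\in\mathbb R$, the function $p\mapsto\mathbb P_p(X,x)$ is non-decreasing on $\{p\in[1,\infty):X\in L^p\}$. -/

import Mathlib

open MeasureTheory ProbabilityTheory

noncomputable section

/-- The essential supremum of a real random variable, with values in `[-∞, ∞]`. -/
def esssup {Ω : Type*} [MeasurableSpace Ω] (μ : Measure Ω) (X : Ω → ℝ) : EReal :=
  essSup (fun ω => (X ω : EReal)) μ

/-- The `L^p`-CVAR at level `l ∈ [0, 1)`: the infimum over real `c` of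
`‖(X - c)_+‖_p / (1 - l) + c`. The infimum is over a set bounded below by `E X`; it is
attained if `0 < l`, but in general not if `l = 0`. -/
def cvar {Ω : Type*} [MeasurableSpace Ω] (p : ℝ) (μ : Measure Ω) (X : Ω → ℝ) (l : ℝ) : ℝ :=
  ⨅ c : ℝ, (1 / (1 - l) * lpNorm (fun ω => max (X ω - c) 0) (ENNReal.ofReal p) μ + c)

open Classical in
/-- The buffered probability `P_p(X, x)`. For `E X < x < esssup X` it is `1 - l`, with `l` the
unique point of `[0, 1)` at which the `L^p`-CVAR of `X` takes the value `x`. -/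
def bufferedProb {Ω : Type*} [MeasurableSpace Ω] (p : ℝ) (μ : Measure Ω) (X : Ω → ℝ)
    (x : ℝ) : ℝ :=
  if esssup μ X < (x : EReal) then 0
  else if (x : EReal) = esssup μ X then μ.real {ω | (X ω : EReal) = esssup μ X} ^ (1 / p)
  else if ∫ ω, X ω ∂μ < x then 1 - Function.invFunOn (cvar p μ X) (Set.Ico 0 1) x
  else 1

/-- `X` (on `(Ω, μ)`) dominates `Y` (on `(Ω', ν)`) in the second stochastic order:
`E U(X) ≥ E U(Y)` for every increasing concave `U` for which both expectations exist. -/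
def SecondOrderDominates {Ω Ω' : Type*} [MeasurableSpace Ω] [MeasurableSpace Ω']
    (μ : Measure Ω) (X : Ω → ℝ) (ν : Measure Ω') (Y : Ω' → ℝ) : Prop :=
  ∀ U : ℝ → ℝ, Monotone U → ConcaveOn ℝ Set.univ U →
    Integrable (fun ω => U (X ω)) μ → Integrable (fun ω => U (Y ω)) ν →
    ∫ ω, U (Y ω) ∂ν ≤ ∫ ω, U (X ω) ∂μ

/-- The distribution of `X` is the mixture of the distributions of `X₁` and `X₂` with weights
`t` and `1 - t`. -/
def IsMixture {Ω Ω₁ Ω₂ : Type*} [MeasurableSpace Ω] [MeasurableSpace Ω₁] [MeasurableSpace Ω₂]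
    (t : ℝ) (μ : Measure Ω) (X : Ω → ℝ) (μ₁ : Measure Ω₁) (X₁ : Ω₁ → ℝ)
    (μ₂ : Measure Ω₂) (X₂ : Ω₂ → ℝ) : Prop :=
  μ.map X = ENNReal.ofReal t • μ₁.map X₁ + ENNReal.ofReal (1 - t) • μ₂.map X₂

end

/-! Let `N(c) = ‖(X - c)_+‖_p`. For `E X < x < ess sup X`, the CVAR at level `l` equals `x` exactly
when the line `c ↦ (1 - l)(x - c)` lies below `N` and touches it, so `1 - l` is the infimum of `N(c)
/ (x - c)` over `c < x`. With `a = 1 / (x - c)` this quotient is `‖(1 + a(X - x))_+‖_p`. Allowing `a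
= 0`, where the norm is `1`, gives an infimum over `a ≥ 0` that also produces the other three
branches of the definition: this is `bufferedProb_eq_tiltInf`, resting on `cvar_eq_iff`.

The properties then come from the norm at fixed `a`. It is monotone in `X - x` and in `p`, and its
`p`-th power is the expectation of an increasing convex function of `X`, hence affine in the law.
Quasi-convexity combines two values of `a` by Minkowski's inequality. Strict monotonicity and
continuity also need control of large `a`: unless `X ≤ x` almost surely, the norm grows at least
linearly in `a`, so the infimum is attained. -/

open Filter Topology

/-! ### The norm of `(1 + a Z)_+` and its infimum over `a ≥ 0` -/

section TiltNorm

variable {Ω Ω' : Type*} [MeasurableSpace Ω] [MeasurableSpace Ω']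
  {μ : Measure Ω} {ν : Measure Ω'} {p a b : ℝ} {Z W : Ω → ℝ}

/-- The `L^p` norm of `(1 + a Z)_+`. -/
noncomputable def tiltNorm {Ω : Type*} [MeasurableSpace Ω] (p : ℝ) (μ : Measure Ω) (Z : Ω → ℝ) (a : ℝ) : ℝ :=
  lpNorm (fun ω => max (1 + a * Z ω) 0) (ENNReal.ofReal p) μ

/-- The infimum over `a ≥ 0` of the `L^p` norm of `(1 + a Z)_+`. The buffered probability of `X`
at `x` is this infimum for `Z = X - x`. -/
noncomputable def tiltInf {Ω : Type*} [MeasurableSpace Ω] (p : ℝ) (μ : Measure Ω) (Z : Ω → ℝ) : ℝ :=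
  ⨅ a : Set.Ici (0 : ℝ), tiltNorm p μ Z a

lemma tiltNorm_nonneg : 0 ≤ tiltNorm p μ Z a := lpNorm_nonneg

lemma tiltInf_le (ha : 0 ≤ a) : tiltInf p μ Z ≤ tiltNorm p μ Z a :=
  ciInf_le (f := fun a : Set.Ici (0 : ℝ) => tiltNorm p μ Z a)
    ⟨0, by rintro _ ⟨b, rfl⟩; exact tiltNorm_nonneg⟩ ⟨a, ha⟩

lemma le_tiltInf {r : ℝ} (h : ∀ a, 0 ≤ a → r ≤ tiltNorm p μ Z a) : r ≤ tiltInf p μ Z :=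
  le_ciInf fun a => h a a.2

lemma tiltInf_nonneg : 0 ≤ tiltInf p μ Z := le_tiltInf fun _ _ => tiltNorm_nonneg

lemma lpNorm_mono_ae_real {q : ENNReal} {f g : Ω → ℝ} (hg : MemLp g q μ)
    (h : ∀ᵐ ω ∂μ, |f ω| ≤ g ω) : lpNorm f q μ ≤ lpNorm g q μ := by
  by_cases hf : AEStronglyMeasurable f μ
  · rw [← toReal_eLpNorm hf, ← toReal_eLpNorm hg.aestronglyMeasurable]
    exact ENNReal.toReal_mono hg.eLpNorm_ne_top (eLpNorm_mono_ae_real h)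
  -- `lpNorm` is `0` by default on functions that are not a.e. strongly measurable.
  · simp [hf]

lemma MeasureTheory.MemLp.tilt [IsFiniteMeasure μ] {q : ENNReal} (hZ : MemLp Z q μ) (a : ℝ) :
    MemLp (fun ω => max (1 + a * Z ω) 0) q μ := by
  have h : MemLp (fun ω => 1 + a * Z ω) q μ := (memLp_const (1 : ℝ)).add (hZ.const_mul a)
  exact h.pos_part

lemma MeasureTheory.MemLp.integrable_of_one_le [IsFiniteMeasure μ] (hp : 1 ≤ p)
    (hZ : MemLp Z (ENNReal.ofReal p) μ) : Integrable Z μ :=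
  hZ.integrable (by simpa using hp)

lemma tiltNorm_mono_ae [IsFiniteMeasure μ] (hW : MemLp W (ENNReal.ofReal p) μ)
    (ha : 0 ≤ a) (h : ∀ᵐ ω ∂μ, Z ω ≤ W ω) : tiltNorm p μ Z a ≤ tiltNorm p μ W a := by
  refine lpNorm_mono_ae_real (hW.tilt a) ?_
  filter_upwards [h] with ω hω
  rw [abs_of_nonneg (le_max_right _ _)]
  gcongr

lemma tiltInf_mono_ae [IsFiniteMeasure μ] (hW : MemLp W (ENNReal.ofReal p) μ)
    (h : ∀ᵐ ω ∂μ, Z ω ≤ W ω) : tiltInf p μ Z ≤ tiltInf p μ W :=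
  le_tiltInf fun _ ha => (tiltInf_le ha).trans (tiltNorm_mono_ae hW ha h)

lemma tiltNorm_zero [IsProbabilityMeasure μ] (hp : 1 ≤ p) : tiltNorm p μ Z 0 = 1 := by
  have : 0 < p := by linarith
  simp [tiltNorm, lpNorm_const, this, IsProbabilityMeasure.ne_zero μ]

lemma tiltInf_le_one [IsProbabilityMeasure μ] (hp : 1 ≤ p) : tiltInf p μ Z ≤ 1 :=
  (tiltInf_le le_rfl).trans_eq (tiltNorm_zero hp)

lemma lpNorm_ofReal_eq (hp : 1 ≤ p) {f : Ω → ℝ} (hf : AEStronglyMeasurable f μ) (h0 : 0 ≤ f) :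
    lpNorm f (ENNReal.ofReal p) μ = (∫ ω, f ω ^ p ∂μ) ^ (1 / p) := by
  have hp0 : 0 < p := by linarith
  rw [lpNorm_eq_integral_norm_rpow_toReal (by simpa using hp0) ENNReal.ofReal_ne_top hf,
    ENNReal.toReal_ofReal hp0.le, one_div]
  simp_rw [Real.norm_of_nonneg (h0 _)]

lemma tiltNorm_eq_integral [IsFiniteMeasure μ] (hp : 1 ≤ p) (hZ : MemLp Z (ENNReal.ofReal p) μ) :
    tiltNorm p μ Z a = (∫ ω, max (1 + a * Z ω) 0 ^ p ∂μ) ^ (1 / p) :=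
  lpNorm_ofReal_eq hp (hZ.tilt a).aestronglyMeasurable fun _ => le_max_right _ _

lemma tiltNorm_rpow [IsFiniteMeasure μ] (hp : 1 ≤ p) (hZ : MemLp Z (ENNReal.ofReal p) μ) :
    tiltNorm p μ Z a ^ p = ∫ ω, max (1 + a * Z ω) 0 ^ p ∂μ := by
  have hp0 : p ≠ 0 := by linarith
  rw [tiltNorm_eq_integral hp hZ, ← Real.rpow_mul (integral_nonneg fun _ => by positivity),
    one_div_mul_cancel hp0, Real.rpow_one]

lemma integrable_tilt_rpow [IsFiniteMeasure μ] (hp : 1 ≤ p) (hZ : MemLp Z (ENNReal.ofReal p) μ)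
    (a : ℝ) : Integrable (fun ω => max (1 + a * Z ω) 0 ^ p) μ := by
  have hp0 : 0 < p := by linarith
  have := (hZ.tilt a).integrable_norm_rpow (by simpa using hp0) ENNReal.ofReal_ne_top
  simpa [ENNReal.toReal_ofReal hp0.le, abs_of_nonneg (le_max_right _ (0 : ℝ))] using this

lemma MeasureTheory.MemLp.sub_const [IsFiniteMeasure μ] {q : ENNReal} (hZ : MemLp Z q μ) (c : ℝ) :
    MemLp (fun ω => Z ω - c) q μ := hZ.sub (memLp_const c)

/-- Weighted triangle inequality for the positive parts. -/
lemma tiltNorm_le_of_le [IsFiniteMeasure μ] {Y : Ω → ℝ} {c s t : ℝ} (hp : 1 ≤ p) (hs : 0 ≤ s)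
    (ht : 0 ≤ t) (hZ : MemLp Z (ENNReal.ofReal p) μ) (hW : MemLp W (ENNReal.ofReal p) μ)
    (h : ∀ ω, 1 + c * Y ω ≤ s * (1 + a * Z ω) + t * (1 + b * W ω)) :
    tiltNorm p μ Y c ≤ s * tiltNorm p μ Z a + t * tiltNorm p μ W b := by
  have key : ∀ r : ℝ, 0 ≤ r → ∀ f : Ω → ℝ,
      lpNorm (r • f) (ENNReal.ofReal p) μ = r * lpNorm f (ENNReal.ofReal p) μ := by
    intro r hr f
    rw [lpNorm_const_smul]
    simp [abs_of_nonneg hr]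
  have h1 := (hZ.tilt a).const_smul s
  have h2 := (hW.tilt b).const_smul t
  rw [tiltNorm, tiltNorm, tiltNorm, ← key s hs, ← key t ht]
  refine (lpNorm_mono_real (h1.add h2) fun ω => ?_).trans (lpNorm_add_le h1 (by simpa using hp))
  simp only [Pi.add_apply, Pi.smul_apply, smul_eq_mul]
  rw [Real.norm_of_nonneg (le_max_right _ _)]
  refine max_le ((h ω).trans ?_) (by positivity)
  gcongr <;> exact le_max_left _ _

/-- Minkowski's inequality applied to `(1 + a W)_+ ≤ (1 + a Z)_+ + a |W - Z|`. -/
lemma tiltNorm_le_add [IsFiniteMeasure μ] (hp : 1 ≤ p) (ha : 0 ≤ a)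
    (hZ : MemLp Z (ENNReal.ofReal p) μ) (hW : MemLp W (ENNReal.ofReal p) μ) :
    tiltNorm p μ W a ≤ tiltNorm p μ Z a +
      a * lpNorm (fun ω => W ω - Z ω) (ENNReal.ofReal p) μ := by
  have h2 := (hW.sub hZ).const_smul a
  have h3 := (hZ.tilt a).add (h2.norm)
  have h4 : a * lpNorm (fun ω => W ω - Z ω) (ENNReal.ofReal p) μ =
      lpNorm (fun ω => ‖(a • (W - Z)) ω‖) (ENNReal.ofReal p) μ := by
    rw [lpNorm_norm h2.aestronglyMeasurable, lpNorm_const_smul]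
    simp only [coe_nnnorm, Real.norm_eq_abs, abs_of_nonneg ha]
    rfl
  rw [h4]
  refine (lpNorm_mono_real h3 fun ω => ?_).trans (lpNorm_add_le (hZ.tilt a) (by simpa using hp))
  simp only [Pi.add_apply, Pi.smul_apply, Pi.sub_apply, smul_eq_mul]
  rw [Real.norm_of_nonneg (le_max_right _ _), Real.norm_eq_abs]
  refine max_le ?_ (by positivity)
  have := le_max_left (1 + a * Z ω) 0
  have := le_abs_self (a * (W ω - Z ω))
  linarith

lemma continuous_tiltNorm [IsFiniteMeasure μ] (hp : 1 ≤ p) (hZ : MemLp Z (ENNReal.ofReal p) μ) :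
    Continuous (tiltNorm p μ Z) := by
  have key : ∀ a b, tiltNorm p μ Z a ≤ tiltNorm p μ Z b +
      lpNorm Z (ENNReal.ofReal p) μ * dist a b := by
    intro a b
    have h2 := hZ.const_smul (a - b)
    have h3 := (hZ.tilt b).add (h2.norm)
    have h4 : lpNorm Z (ENNReal.ofReal p) μ * dist a b =
        lpNorm (fun ω => ‖((a - b) • Z) ω‖) (ENNReal.ofReal p) μ := by
      rw [lpNorm_norm h2.aestronglyMeasurable, lpNorm_const_smul, mul_comm, Real.dist_eq]
      simp
    rw [h4]
    refine (lpNorm_mono_real h3 fun ω => ?_).trans (lpNorm_add_le (hZ.tilt b) (by simpa using hp))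
    simp only [Pi.add_apply, Pi.smul_apply, smul_eq_mul]
    rw [Real.norm_of_nonneg (le_max_right _ _), Real.norm_eq_abs]
    refine max_le ?_ (by positivity)
    have := le_max_left (1 + b * Z ω) 0
    have := le_abs_self ((a - b) * Z ω)
    linarith
  exact (LipschitzWith.of_le_add_mul ⟨_, lpNorm_nonneg⟩ key).continuous

/-- Coercivity in `a`, from `a Z_+ ≤ (1 + a Z)_+`. -/
lemma mul_lpNorm_posPart_le_tiltNorm [IsFiniteMeasure μ] (hZ : MemLp Z (ENNReal.ofReal p) μ)
    (ha : 0 ≤ a) :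
    a * lpNorm (fun ω => max (Z ω) 0) (ENNReal.ofReal p) μ ≤ tiltNorm p μ Z a := by
  have : a * lpNorm (fun ω => max (Z ω) 0) (ENNReal.ofReal p) μ =
      lpNorm (a • fun ω => max (Z ω) 0) (ENNReal.ofReal p) μ := by
    rw [lpNorm_const_smul]
    simp [abs_of_nonneg ha]
  rw [this]
  refine lpNorm_mono_real (hZ.tilt a) fun ω => ?_
  simp only [Pi.smul_apply, smul_eq_mul]
  rw [Real.norm_of_nonneg (by positivity), mul_max_of_nonneg _ _ ha, mul_zero]
  gcongr
  linarith

lemma lpNorm_posPart_pos (hp : 1 ≤ p) (hZ : MemLp Z (ENNReal.ofReal p) μ)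
    (h : ¬ ∀ᵐ ω ∂μ, Z ω ≤ 0) : 0 < lpNorm (fun ω => max (Z ω) 0) (ENNReal.ofReal p) μ := by
  have hp0 : 0 < p := by linarith
  refine lpNorm_nonneg.lt_of_ne fun h0 => h ?_
  have := (lpNorm_eq_zero hZ.pos_part (by simpa using hp0)).1 h0.symm
  filter_upwards [this] with ω hω
  simpa using hω

/-- Markov's inequality: the tilt is at least `1` where `Z ≥ 0`. The bound does not depend on `a`,
so it passes to the infimum. -/
lemma lpNorm_indicator_le_tiltNorm [IsFiniteMeasure μ] (hp : 1 ≤ p)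
    (hZ : MemLp Z (ENNReal.ofReal p) μ) (ha : 0 ≤ a) {s : Set Ω} (hs : s ⊆ {ω | 0 ≤ Z ω}) :
    μ.real s ^ (1 / p) ≤ tiltNorm p μ Z a := by
  have hp0 : 0 < p := by linarith
  rw [tiltNorm_eq_integral hp hZ]
  refine Real.rpow_le_rpow (by positivity) ?_ (by positivity)
  have h1 := mul_meas_ge_le_integral_of_nonneg (μ := μ)
    (f := fun ω => max (1 + a * Z ω) 0 ^ p) (.of_forall fun _ => by positivity)
    (integrable_tilt_rpow hp hZ a) 1
  rw [one_mul] at h1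
  refine le_trans (measureReal_mono fun ω hω => ?_) h1
  have : 0 ≤ a * Z ω := mul_nonneg ha (hs hω)
  exact Real.one_le_rpow (le_max_of_le_left (by linarith)) hp0.le

/-- For `a ≥ 1 / m`, with `m = ‖Z_+‖_p > 0`, the norm is at least `1`, its value at `a = 0`; so a
minimiser on `[0, 1 / m]` is a global one. -/
lemma exists_tiltInf_eq [IsProbabilityMeasure μ] (hp : 1 ≤ p)
    (hZ : MemLp Z (ENNReal.ofReal p) μ) (h : ¬ ∀ᵐ ω ∂μ, Z ω ≤ 0) :
    ∃ a, 0 ≤ a ∧ tiltInf p μ Z = tiltNorm p μ Z a := by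
  have hm := lpNorm_posPart_pos hp hZ h
  set m := lpNorm (fun ω => max (Z ω) 0) (ENNReal.ofReal p) μ
  obtain ⟨a, ha, hmin⟩ := isCompact_Icc.exists_isMinOn
    (Set.nonempty_Icc.2 (one_div_pos.2 hm).le) (continuous_tiltNorm hp hZ).continuousOn
  refine ⟨a, ha.1, le_antisymm (tiltInf_le ha.1) (le_tiltInf fun b hb => ?_)⟩
  rcases le_total b (1 / m) with hbm | hbm
  · exact hmin ⟨hb, hbm⟩
  · have h1 : tiltNorm p μ Z a ≤ 1 :=
      (hmin (Set.left_mem_Icc.2 (one_div_pos.2 hm).le)).trans_eq (tiltNorm_zero hp)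
    have h2 := mul_lpNorm_posPart_le_tiltNorm hZ hb
    have h3 : 1 ≤ b * m := by rwa [div_le_iff₀ hm] at hbm
    linarith

lemma tiltInf_pos [IsProbabilityMeasure μ] (hp : 1 ≤ p)
    (hZ : MemLp Z (ENNReal.ofReal p) μ) (h : ¬ ∀ᵐ ω ∂μ, Z ω ≤ 0) : 0 < tiltInf p μ Z := by
  refine lt_of_lt_of_le ?_ (le_tiltInf fun a ha =>
    lpNorm_indicator_le_tiltNorm hp hZ ha (s := {ω | 0 < Z ω}) fun ω (hω : 0 < Z ω) => hω.le)
  refine Real.rpow_pos_of_pos (ENNReal.toReal_pos (fun h0 => h ?_) (measure_ne_top _ _)) _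
  rw [ae_iff]
  simpa using h0

/-- Bernoulli's inequality gives `(1 + a Z)_+ ^ p ≥ 1 + p a Z`, whose expectation is at least `1`.
-/
lemma tiltInf_eq_one [IsProbabilityMeasure μ] (hp : 1 ≤ p)
    (hZ : MemLp Z (ENNReal.ofReal p) μ) (h : 0 ≤ ∫ ω, Z ω ∂μ) : tiltInf p μ Z = 1 := by
  refine (tiltInf_le_one hp).antisymm (le_tiltInf fun a ha => ?_)
  have hint := hZ.integrable_of_one_le hp
  have h1 : 1 ≤ ∫ ω, max (1 + a * Z ω) 0 ^ p ∂μ := by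
    have : 1 ≤ ∫ ω, (1 + p * (a * Z ω)) ∂μ := by
      rw [integral_add (integrable_const _) ((hint.const_mul a).const_mul p),
        integral_const_mul, integral_const_mul]
      simp only [integral_const, probReal_univ, smul_eq_mul, mul_one, le_add_iff_nonneg_right]
      positivity
    refine this.trans (integral_mono ((integrable_const _).add ((hint.const_mul a).const_mul p))
      (integrable_tilt_rpow hp hZ a) fun ω => ?_)
    have h2 := one_add_mul_self_le_rpow_one_add (s := max (1 + a * Z ω) 0 - 1)
      (by linarith [le_max_right (1 + a * Z ω) 0]) hp
    rw [add_sub_cancel] at h2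
    refine le_trans ?_ h2
    have := le_max_left (1 + a * Z ω) 0
    simp only
    gcongr
    linarith
  rw [tiltNorm_eq_integral hp hZ]
  exact Real.one_le_rpow h1 (by positivity)

/-- The right derivative of `a ↦ E (1 + a Z)_+ ^ p` at `0` is `p E Z < 0`, so the norm drops below
its value `1` at `a = 0`. -/
lemma tiltInf_lt_one [IsProbabilityMeasure μ] (hp : 1 ≤ p)
    (hZ : MemLp Z (ENNReal.ofReal p) μ) (h : ∫ ω, Z ω ∂μ < 0) : tiltInf p μ Z < 1 := by
  have hp0 : 0 < p := by linarith
  have hint := hZ.integrable_of_one_le hp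
  have hlim : Tendsto (fun a : ℝ => ∫ ω, a⁻¹ * (max (1 + a * Z ω) 0 ^ p - 1) ∂μ) (𝓝[>] 0)
      (𝓝 (∫ ω, p * Z ω ∂μ)) := by
    refine tendsto_integral_filter_of_dominated_convergence
      -- For `0 < a ≤ 1` the difference quotient is at least `p Z` by Bernoulli and at most `(1 +
      -- Z)_+ ^ p - 1` by convexity.
      (fun ω => p * |Z ω| + (max (1 + 1 * Z ω) 0 ^ p + 1)) ?_ ?_ ?_ ?_
    · exact .of_forall fun a =>
        (((integrable_tilt_rpow hp hZ a).sub (integrable_const 1)).const_mul _).aestronglyMeasurable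
    · filter_upwards [Ioc_mem_nhdsGT one_pos] with a ha
      refine .of_forall fun ω => ?_
      have h0 : 0 ≤ max (1 + 1 * Z ω) 0 ^ p := by positivity
      have hlow := one_add_mul_self_le_rpow_one_add (s := max (1 + a * Z ω) 0 - 1)
        (by linarith [le_max_right (1 + a * Z ω) 0]) hp
      rw [add_sub_cancel] at hlow
      have hup : max (1 + a * Z ω) 0 ^ p ≤ a * max (1 + 1 * Z ω) 0 ^ p + (1 - a) * 1 ^ p := by
        refine le_trans ?_ ((convexOn_rpow hp).2 (le_max_right (1 + 1 * Z ω) 0)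
          (zero_le_one (α := ℝ)) ha.1.le (sub_nonneg.2 ha.2) (by ring))
        simp only [smul_eq_mul]
        have := mul_le_mul_of_nonneg_left (le_max_left (1 + 1 * Z ω) 0) ha.1.le
        refine Real.rpow_le_rpow (le_max_right _ _) (max_le (by linarith) ?_) hp0.le
        have := ha.2
        have := ha.1
        have : 0 ≤ a * max (1 + 1 * Z ω) 0 := by positivity
        linarith
      rw [Real.one_rpow] at hup
      have h1 : p * (a * Z ω) ≤ p * (max (1 + a * Z ω) 0 - 1) := by
        gcongr
        linarith [le_max_left (1 + a * Z ω) 0]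
      have h2 : p * -(a * |Z ω|) ≤ p * (a * Z ω) := by
        gcongr
        have := mul_le_mul_of_nonneg_left (neg_abs_le (Z ω)) ha.1.le
        linarith
      have h3 : 0 ≤ a * (p * |Z ω|) := mul_nonneg ha.1.le (by positivity)
      have h4 : 0 ≤ a * max (1 + 1 * Z ω) 0 ^ p := mul_nonneg ha.1.le h0
      have := ha.1
      rw [Real.norm_eq_abs, abs_mul, abs_of_pos (inv_pos.2 ha.1), inv_mul_le_iff₀ ha.1, abs_le]
      constructor <;> linarith
    · exact (hint.abs.const_mul p).add ((integrable_tilt_rpow hp hZ 1).add (integrable_const 1))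
    · refine .of_forall fun ω => ?_
      have hd : HasDerivAt (fun a : ℝ => (1 + a * Z ω) ^ p) (p * Z ω) 0 := by
        have h1 : HasDerivAt (fun a : ℝ => 1 + a * Z ω) (Z ω) 0 := by
          simpa using ((hasDerivAt_id (0 : ℝ)).mul_const (Z ω)).const_add 1
        simpa [mul_comm] using h1.rpow_const (p := p) (by simp)
      have ht := hd.tendsto_slope_zero_right
      refine ht.congr' ?_
      have hc : Tendsto (fun a : ℝ => 1 + a * Z ω) (𝓝[>] 0) (𝓝 1) := by
        have : Continuous fun a : ℝ => 1 + a * Z ω := by fun_prop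
        simpa using (this.tendsto 0).mono_left nhdsWithin_le_nhds
      filter_upwards [hc.eventually (lt_mem_nhds one_pos)] with a ha
      simp [max_eq_left ha.le]
  have hneg : ∫ ω, p * Z ω ∂μ < 0 := by
    rw [integral_const_mul]; exact mul_neg_of_pos_of_neg hp0 h
  obtain ⟨a, ha, ha0⟩ := ((hlim.eventually (gt_mem_nhds hneg)).and
    (self_mem_nhdsWithin (s := Set.Ioi (0 : ℝ)))).exists
  have ha0 : 0 < a := ha0
  refine (tiltInf_le ha0.le).trans_lt ?_
  rw [tiltNorm_eq_integral hp hZ]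
  refine Real.rpow_lt_one (integral_nonneg fun _ => by positivity) ?_ (by positivity)
  rw [integral_const_mul, integral_sub (integrable_tilt_rpow hp hZ a) (integrable_const 1)] at ha
  simp only [integral_const, probReal_univ, smul_eq_mul, mul_one] at ha
  have := (mul_neg_iff.1 ha).resolve_right (by rintro ⟨h1, -⟩; exact absurd h1 (by simp [ha0.le]))
  linarith [this.2]

lemma tiltInf_eq_zero {δ : ℝ} (hδ : 0 < δ)
    (h : ∀ᵐ ω ∂μ, Z ω ≤ -δ) : tiltInf p μ Z = 0 := by
  refine le_antisymm ((tiltInf_le (one_div_pos.2 hδ).le).trans ?_) tiltInf_nonneg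
  refine (lpNorm_mono_ae_real (g := 0) MemLp.zero ?_).trans_eq (lpNorm_zero _ _)
  filter_upwards [h] with ω hω
  have : 1 / δ * Z ω ≤ 1 / δ * -δ := by gcongr
  have h2 : 1 / δ * -δ = -1 := by field_simp
  simp only [Pi.zero_apply, abs_nonpos_iff, max_eq_right_iff]
  linarith

/-- As `a → ∞`, `(1 + a Z)_+` tends to the indicator of `{Z = 0}`; the infimum is this limit and
need not be attained. -/
lemma tiltInf_eq_of_ae_nonpos [IsProbabilityMeasure μ] (hp : 1 ≤ p)
    (hZ : MemLp Z (ENNReal.ofReal p) μ) (h : ∀ᵐ ω ∂μ, Z ω ≤ 0) :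
    tiltInf p μ Z = μ.real {ω | Z ω = 0} ^ (1 / p) := by
  have hp0 : 0 < p := by linarith
  refine le_antisymm ?_ (le_tiltInf fun a ha =>
    lpNorm_indicator_le_tiltNorm hp hZ ha fun ω (hω : Z ω = 0) => hω.ge)
  have hnull : NullMeasurableSet {ω | Z ω = 0} μ :=
    hZ.aemeasurable.nullMeasurableSet_preimage (measurableSet_singleton 0)
  have hlim : Tendsto (fun n : ℕ => ∫ ω, max (1 + (n : ℝ) * Z ω) 0 ^ p ∂μ) atTop
      (𝓝 (∫ ω, {ω | Z ω = 0}.indicator (fun _ => (1 : ℝ)) ω ∂μ)) := by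
    refine tendsto_integral_of_dominated_convergence (fun _ => 1)
      (fun n => (integrable_tilt_rpow hp hZ n).aestronglyMeasurable) (integrable_const _) ?_ ?_
    · intro n
      filter_upwards [h] with ω hω
      rw [Real.norm_of_nonneg (by positivity)]
      refine Real.rpow_le_one (le_max_right _ _) (max_le ?_ zero_le_one) hp0.le
      have := mul_nonpos_of_nonneg_of_nonpos (Nat.cast_nonneg (α := ℝ) n) hω
      linarith
    · filter_upwards [h] with ω hω
      rcases hω.eq_or_lt with h0 | h0
      · simp [h0]
      · rw [Set.indicator_of_notMem (by simpa using h0.ne)]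
        refine tendsto_const_nhds.congr' ?_
        have hbot : Tendsto (fun n : ℕ => (n : ℝ) * Z ω) atTop atBot :=
          tendsto_natCast_atTop_atTop.atTop_mul_const_of_neg h0
        filter_upwards [hbot.eventually (eventually_le_atBot (-1))] with n hn
        rw [max_eq_right (by linarith), Real.zero_rpow hp0.ne']
  rw [integral_indicator₀ hnull, setIntegral_const, smul_eq_mul, mul_one] at hlim
  refine ge_of_tendsto' (hlim.rpow_const (p := 1 / p) (.inr (by positivity))) fun n => ?_
  rw [← tiltNorm_eq_integral hp hZ]
  exact tiltInf_le (Nat.cast_nonneg n)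

end TiltNorm

/-! ### The infimum formula for the buffered probability, and its consequences on one space -/

section BufferedProb

variable {Ω : Type*} [MeasurableSpace Ω] {μ : Measure Ω} {p x : ℝ} {X : Ω → ℝ}

lemma exists_ae_sub_le_of_esssup_lt (h : esssup μ X < (x : EReal)) :
    ∃ δ, 0 < δ ∧ ∀ᵐ ω ∂μ, X ω - x ≤ -δ := by
  obtain ⟨y, hy, hyx⟩ := EReal.lt_iff_exists_real_btwn.1 h
  refine ⟨x - y, sub_pos.2 (EReal.coe_lt_coe_iff.1 hyx), ?_⟩
  filter_upwards [ae_lt_of_essSup_lt hy] with ω hω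
  have := EReal.coe_lt_coe_iff.1 hω
  linarith

lemma esssup_le_iff : esssup μ X ≤ (x : EReal) ↔ ∀ᵐ ω ∂μ, X ω - x ≤ 0 := by
  refine ⟨fun h => ?_, fun h => essSup_le_of_ae_le _ ?_⟩
  · filter_upwards [ae_le_essSup (μ := μ) (f := fun ω => (X ω : EReal))] with ω hω
    exact sub_nonpos.2 (EReal.coe_le_coe_iff.1 (hω.trans h))
  · filter_upwards [h] with ω hω
    exact EReal.coe_le_coe_iff.2 (sub_nonpos.1 hω)

lemma tiltNorm_sub_eq_div {c : ℝ} (hc : c < x) :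
    tiltNorm p μ (fun ω => X ω - x) (1 / (x - c)) =
      lpNorm (fun ω => max (X ω - c) 0) (ENNReal.ofReal p) μ / (x - c) := by
  have hxc : 0 < x - c := sub_pos.2 hc
  have : (fun ω => max (1 + 1 / (x - c) * (X ω - x)) 0) =
      (1 / (x - c)) • fun ω => max (X ω - c) 0 := by
    ext ω
    simp only [Pi.smul_apply, smul_eq_mul]
    rw [mul_max_of_nonneg _ _ (one_div_pos.2 hxc).le, mul_zero]
    congr 1
    field_simp
    ring
  rw [tiltNorm, this, lpNorm_const_smul, coe_nnnorm, Real.norm_of_nonneg (one_div_pos.2 hxc).le]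
  ring

lemma tiltInf_sub_mul_le (c : ℝ) : tiltInf p μ (fun ω => X ω - x) * (x - c) ≤
    lpNorm (fun ω => max (X ω - c) 0) (ENNReal.ofReal p) μ := by
  rcases lt_or_ge c x with hc | hc
  · have hxc : 0 < x - c := sub_pos.2 hc
    rw [← le_div_iff₀ hxc, ← tiltNorm_sub_eq_div hc]
    exact tiltInf_le (one_div_pos.2 hxc).le
  · exact (mul_nonpos_of_nonneg_of_nonpos tiltInf_nonneg (sub_nonpos.2 hc)).trans lpNorm_nonneg

variable [IsProbabilityMeasure μ]

lemma integral_sub_const (hX : Integrable X μ) (c : ℝ) :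
    ∫ ω, (X ω - c) ∂μ = ∫ ω, X ω ∂μ - c := by
  rw [integral_sub hX (integrable_const c)]
  simp

/-- The minimising `a` is nonzero because the infimum is below `1`, so it has the form `1 / (x -
c)`. -/
lemma exists_tiltInf_sub_eq_div (hp : 1 ≤ p) (hX : MemLp X (ENNReal.ofReal p) μ)
    (h1 : ∫ ω, X ω ∂μ < x) (h2 : (x : EReal) < esssup μ X) :
    ∃ c < x, tiltInf p μ (fun ω => X ω - x) * (x - c) =
      lpNorm (fun ω => max (X ω - c) 0) (ENNReal.ofReal p) μ := by
  have hZ := hX.sub_const x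
  obtain ⟨a, ha, hinf⟩ := exists_tiltInf_eq hp hZ (esssup_le_iff.not.1 h2.not_ge)
  have hlt := tiltInf_lt_one hp hZ
    (by rw [integral_sub_const (hX.integrable_of_one_le hp)]; linarith)
  have ha : 0 < a := ha.lt_of_ne (by rintro rfl; rw [hinf, tiltNorm_zero hp] at hlt; simp at hlt)
  have hc : x - 1 / a < x := sub_lt_self x (one_div_pos.2 ha)
  refine ⟨x - 1 / a, hc, ?_⟩
  have := tiltNorm_sub_eq_div (p := p) (μ := μ) (X := X) hc
  rw [sub_sub_cancel, one_div_one_div] at this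
  rw [hinf, sub_sub_cancel, this, div_mul_cancel₀ _ (one_div_pos.2 ha).ne']

lemma bddBelow_cvar (hp : 1 ≤ p) (hX : MemLp X (ENNReal.ofReal p) μ) {l : ℝ}
    (hl : l ∈ Set.Ico (0 : ℝ) 1) : BddBelow (Set.range fun c : ℝ =>
      1 / (1 - l) * lpNorm (fun ω => max (X ω - c) 0) (ENNReal.ofReal p) μ + c) := by
  refine ⟨∫ ω, X ω ∂μ, ?_⟩
  rintro _ ⟨c, rfl⟩
  -- At `x = E X` the infimum is `1`, which gives `E X - c ≤ ‖(X - c)_+‖_p`.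
  have h1 := tiltInf_sub_mul_le (p := p) (μ := μ) (X := X) (x := ∫ ω, X ω ∂μ) c
  rw [tiltInf_eq_one hp (hX.sub_const _)
    (by rw [integral_sub_const (hX.integrable_of_one_le hp), sub_self]), one_mul] at h1
  have h2 : 1 ≤ 1 / (1 - l) := by
    rw [le_div_iff₀ (sub_pos.2 hl.2)]
    linarith [hl.1]
  have h3 := mul_le_mul_of_nonneg_right h2
    (lpNorm_nonneg (f := fun ω => max (X ω - c) 0) (p := ENNReal.ofReal p) (μ := μ))
  simp only
  linarith

/-- With `G` the infimum, the line `G (x - c)` supports `‖(X - c)_+‖_p` from below and touches it at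
some `c₀ < x`. Hence the CVAR is `x` for `1 - l = G`, and the value at `c₀` is below `x` for `1 - l
> G`. For `1 - l < G` the objective exceeds `x` by a margin uniform in `c`. -/
lemma cvar_eq_iff (hp : 1 ≤ p) (hX : MemLp X (ENNReal.ofReal p) μ)
    (h1 : ∫ ω, X ω ∂μ < x) (h2 : (x : EReal) < esssup μ X) {l : ℝ}
    (hl : l ∈ Set.Ico (0 : ℝ) 1) :
    cvar p μ X l = x ↔ 1 - l = tiltInf p μ (fun ω => X ω - x) := by
  have hpos := tiltInf_pos hp (hX.sub_const x) (esssup_le_iff.not.1 h2.not_ge)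
  obtain ⟨c₀, hc₀, heq⟩ := exists_tiltInf_sub_eq_div hp hX h1 h2
  have hle := tiltInf_sub_mul_le (p := p) (μ := μ) (X := X) (x := x)
  set G := tiltInf p μ (fun ω => X ω - x)
  have hl1 : 0 < 1 - l := sub_pos.2 hl.2
  have hbdd := bddBelow_cvar hp hX hl
  have hupper : cvar p μ X l ≤ 1 / (1 - l) * (G * (x - c₀)) + c₀ := by
    rw [heq]; exact ciInf_le hbdd c₀
  rcases lt_trichotomy (1 - l) G with hlt | heq' | hgt
  · refine iff_of_false (fun hx => ?_) hlt.ne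
    obtain ⟨y, hxy, hy⟩ := EReal.lt_iff_exists_real_btwn.1 h2
    have hxy : x < y := EReal.coe_lt_coe_iff.1 hxy
    have hmy := lpNorm_posPart_pos hp (hX.sub_const y) (esssup_le_iff.not.1 hy.not_ge)
    set m := lpNorm (fun ω => max (X ω - y) 0) (ENNReal.ofReal p) μ
    have hκ : 0 < 1 / (1 - l) - 1 / G := sub_pos.2 (one_div_lt_one_div_of_lt hl1 hlt)
    -- The first bound serves `c ≥ y`, where the objective is at least `c`; the second serves `c ≤
    -- y`, where the norm is at least `m`.
    have hmin : x < min y (x + (1 / (1 - l) - 1 / G) * m) :=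
      lt_min hxy (lt_add_of_pos_right _ (mul_pos hκ hmy))
    refine (hmin.trans_le (le_ciInf fun c => ?_)).ne hx.symm
    rcases le_total y c with hc | hc
    · have : 0 ≤ 1 / (1 - l) * lpNorm (fun ω => max (X ω - c) 0) (ENNReal.ofReal p) μ :=
        mul_nonneg (one_div_pos.2 hl1).le lpNorm_nonneg
      exact (min_le_left _ _).trans (by linarith)
    · refine (min_le_right _ _).trans ?_
      have hm : m ≤ lpNorm (fun ω => max (X ω - c) 0) (ENNReal.ofReal p) μ := by
        refine lpNorm_mono_real (hX.sub_const c).pos_part fun ω => ?_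
        rw [Real.norm_of_nonneg (le_max_right _ _)]
        gcongr
      have h3 := mul_le_mul_of_nonneg_left hm hκ.le
      have h4 := mul_le_mul_of_nonneg_left (hle c) (one_div_pos.2 hpos).le
      have h5 : 1 / G * (G * (x - c)) = x - c := by field_simp
      linarith
  · refine iff_of_true (le_antisymm ?_ (le_ciInf fun c => ?_)) heq'
    · refine hupper.trans_eq ?_
      rw [heq']
      field_simp
      ring
    · have h4 := mul_le_mul_of_nonneg_left (hle c) (one_div_pos.2 hpos).le
      have h5 : 1 / G * (G * (x - c)) = x - c := by field_simp
      rw [heq']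
      linarith
  · refine iff_of_false (hupper.trans_lt ?_).ne hgt.ne'
    have h3 : 1 / (1 - l) * G < 1 := by rwa [one_div, inv_mul_lt_iff₀ hl1, mul_one]
    have h4 := mul_lt_mul_of_pos_right h3 (sub_pos.2 hc₀)
    linarith

/-- The buffered probability of `X` at `x` is the infimum over `a ≥ 0` of
`‖(1 + a (X - x))_+‖_p`. -/
theorem bufferedProb_eq_tiltInf (hp : 1 ≤ p) (hX : MemLp X (ENNReal.ofReal p) μ) (x : ℝ) :
    bufferedProb p μ X x = tiltInf p μ fun ω => X ω - x := by
  have hZ := hX.sub_const x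
  have hint := integral_sub_const (hX.integrable_of_one_le hp) x
  rw [bufferedProb]
  split_ifs with h1 h2 h3
  · obtain ⟨δ, hδ, h⟩ := exists_ae_sub_le_of_esssup_lt h1
    exact (tiltInf_eq_zero hδ h).symm
  · rw [tiltInf_eq_of_ae_nonpos hp hZ (esssup_le_iff.1 h2.ge), ← h2]
    simp [sub_eq_zero]
  · have h2 : (x : EReal) < esssup μ X := lt_of_le_of_ne (not_lt.1 h1) h2
    have hG : 1 - tiltInf p μ (fun ω => X ω - x) ∈ Set.Ico (0 : ℝ) 1 :=
      ⟨sub_nonneg.2 (tiltInf_le_one hp),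
        sub_lt_self _ (tiltInf_pos hp hZ (esssup_le_iff.not.1 h2.not_ge))⟩
    have hex : ∃ l ∈ Set.Ico (0 : ℝ) 1, cvar p μ X l = x :=
      ⟨_, hG, (cvar_eq_iff hp hX h3 h2 hG).2 (sub_sub_cancel _ _)⟩
    -- Whichever preimage `invFunOn` selects, `cvar_eq_iff` determines its value.
    exact (cvar_eq_iff hp hX h3 h2 (Function.invFunOn_mem hex)).1 (Function.invFunOn_eq hex)
  · exact (tiltInf_eq_one hp hZ (by rw [hint]; linarith)).symm

lemma bufferedProb_antitone (hp : 1 ≤ p) (hX : MemLp X (ENNReal.ofReal p) μ) :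
    Antitone (bufferedProb p μ X) := fun x y hxy => by
  rw [bufferedProb_eq_tiltInf hp hX, bufferedProb_eq_tiltInf hp hX]
  exact tiltInf_mono_ae (hX.sub_const x) (.of_forall fun ω => sub_le_sub_left hxy _)

/-- With `G` the infimum and `c` optimal for `x`, `G(y)(y - c) ≤ ‖(X - c)_+‖_p = G(x)(x - c) <
G(x)(y - c)`. At `x = E X` such a `c` may fail to exist, but there `G(x) = 1 > G(y)`. -/
lemma bufferedProb_strictAntiOn (hp : 1 ≤ p) (hX : MemLp X (ENNReal.ofReal p) μ) :
    StrictAntiOn (bufferedProb p μ X) {x : ℝ | ∫ ω, X ω ∂μ ≤ x ∧ (x : EReal) < esssup μ X} := by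
  rintro x ⟨hx1, hx2⟩ y ⟨-, hy2⟩ hxy
  rw [bufferedProb_eq_tiltInf hp hX, bufferedProb_eq_tiltInf hp hX]
  have hint := integral_sub_const (hX.integrable_of_one_le hp)
  rcases hx1.eq_or_lt with hx1 | hx1
  · rw [tiltInf_eq_one hp (hX.sub_const x) (by rw [hint]; linarith)]
    exact tiltInf_lt_one hp (hX.sub_const y) (by rw [hint]; linarith)
  · obtain ⟨c, hc, heq⟩ := exists_tiltInf_sub_eq_div hp hX hx1 hx2
    have h1 := tiltInf_sub_mul_le (p := p) (μ := μ) (X := X) (x := y) c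
    rw [← heq] at h1
    have hpos := tiltInf_pos hp (hX.sub_const x) (esssup_le_iff.not.1 hx2.not_ge)
    have h2 : tiltInf p μ (fun ω => X ω - x) * (x - c) <
        tiltInf p μ (fun ω => X ω - x) * (y - c) := by gcongr
    exact lt_of_mul_lt_mul_right (h1.trans_lt h2) (by linarith)

/-- Continuity of the infimum in the `L^p` norm. -/
lemma tiltInf_continuousAt (hp : 1 ≤ p) {Z : Ω → ℝ} (hZ : MemLp Z (ENNReal.ofReal p) μ)
    (h : (∀ᵐ ω ∂μ, Z ω ≤ 0) → tiltInf p μ Z = 0) {ε : ℝ} (hε : 0 < ε) :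
    ∃ δ, 0 < δ ∧ ∀ W : Ω → ℝ, MemLp W (ENNReal.ofReal p) μ →
      lpNorm (fun ω => W ω - Z ω) (ENNReal.ofReal p) μ < δ →
      |tiltInf p μ W - tiltInf p μ Z| < ε := by
  have hupper : ∃ δ, 0 < δ ∧ ∀ W : Ω → ℝ, MemLp W (ENNReal.ofReal p) μ →
      lpNorm (fun ω => W ω - Z ω) (ENNReal.ofReal p) μ < δ →
      tiltInf p μ W < tiltInf p μ Z + ε := by
    obtain ⟨⟨a, ha⟩, haε⟩ := exists_lt_of_ciInf_lt
      (show ⨅ a : Set.Ici (0 : ℝ), tiltNorm p μ Z a < tiltInf p μ Z + ε from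
        lt_add_of_pos_right _ hε)
    have ha : 0 ≤ a := ha
    -- One near-optimal `a` suffices; `a + 1` in the denominator also covers `a = 0`.
    refine ⟨(tiltInf p μ Z + ε - tiltNorm p μ Z a) / (a + 1),
      div_pos (sub_pos.2 haε) (by linarith), fun W hW hd => ?_⟩
    have h1 := (tiltInf_le ha).trans (tiltNorm_le_add hp ha hZ hW)
    rw [lt_div_iff₀ (by linarith)] at hd
    have : 0 ≤ lpNorm (fun ω => W ω - Z ω) (ENNReal.ofReal p) μ := lpNorm_nonneg
    have haε : tiltNorm p μ Z a < tiltInf p μ Z + ε := haε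
    linarith
  have hlower : ∃ δ, 0 < δ ∧ ∀ W : Ω → ℝ, MemLp W (ENNReal.ofReal p) μ →
      lpNorm (fun ω => W ω - Z ω) (ENNReal.ofReal p) μ < δ →
      tiltInf p μ Z - ε < tiltInf p μ W := by
    by_cases h0 : ∀ᵐ ω ∂μ, Z ω ≤ 0
    · refine ⟨1, one_pos, fun W _ _ => ?_⟩
      rw [h h0]
      linarith [tiltInf_nonneg (p := p) (μ := μ) (Z := W)]
    have hm := lpNorm_posPart_pos hp hZ h0
    set m := lpNorm (fun ω => max (Z ω) 0) (ENNReal.ofReal p) μ with hm_def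
    -- For `a ≤ 4 / m` the error `a d` is below `ε / 2`. For `a ≥ 4 / m` the norm for `W` is at
    -- least `a m - a d ≥ a m / 2 ≥ 2`, above the infimum for `Z`.
    refine ⟨min (m / 2) (ε / 2 / (4 / m)), by positivity, fun W hW hd => ?_⟩
    have hsymm : lpNorm (fun ω => Z ω - W ω) (ENNReal.ofReal p) μ =
        lpNorm (fun ω => W ω - Z ω) (ENNReal.ofReal p) μ := lpNorm_sub_comm Z W _ μ
    set d := lpNorm (fun ω => W ω - Z ω) (ENNReal.ofReal p) μ
    have hd1 := hd.trans_le (min_le_left _ _)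
    have hd2 := hd.trans_le (min_le_right _ _)
    rw [lt_div_iff₀ (by positivity)] at hd2
    have hd0 : 0 ≤ d := lpNorm_nonneg
    have key : ∀ a, 0 ≤ a → tiltInf p μ Z - ε / 2 ≤ tiltNorm p μ W a := by
      intro a ha
      have h1 := (tiltInf_le ha).trans (tiltNorm_le_add hp ha hW hZ)
      rw [hsymm] at h1
      rcases le_total a (4 / m) with ham | ham
      · have := mul_le_mul_of_nonneg_right ham hd0
        linarith
      · have h2 := mul_lpNorm_posPart_le_tiltNorm hZ ha
        have h3 := tiltNorm_le_add hp ha hW hZ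
        rw [hsymm] at h3
        have h4 : a * d ≤ a * (m / 2) := by gcongr
        have h5 : 4 ≤ a * m := by rwa [div_le_iff₀ hm] at ham
        have := tiltInf_le_one (μ := μ) (Z := Z) hp
        linarith
    have := le_tiltInf key
    linarith
  obtain ⟨δ₁, hδ₁, h₁⟩ := hupper
  obtain ⟨δ₂, hδ₂, h₂⟩ := hlower
  refine ⟨min δ₁ δ₂, lt_min hδ₁ hδ₂, fun W hW hd => abs_lt.2 ⟨?_, ?_⟩⟩
  · linarith [h₂ W hW (hd.trans_le (min_le_right _ _))]
  · linarith [h₁ W hW (hd.trans_le (min_le_left _ _))]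

/-- Only `X - x` matters, so varying `Y` and `y` together yields continuity both in the random
variable and in the threshold. -/
lemma bufferedProb_continuousAt (hp : 1 ≤ p) (hX : MemLp X (ENNReal.ofReal p) μ)
    (h : (x : EReal) = esssup μ X → μ {ω | X ω = x} = 0) {ε : ℝ} (hε : 0 < ε) :
    ∃ δ, 0 < δ ∧ ∀ Y : Ω → ℝ, MemLp Y (ENNReal.ofReal p) μ → ∀ y : ℝ,
      lpNorm (fun ω => (Y ω - y) - (X ω - x)) (ENNReal.ofReal p) μ < δ →
      |bufferedProb p μ Y y - bufferedProb p μ X x| < ε := by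
  have hzero : (∀ᵐ ω ∂μ, X ω - x ≤ 0) → tiltInf p μ (fun ω => X ω - x) = 0 := fun h0 => by
    have hp0 : 0 < p := by linarith
    rcases (esssup_le_iff.2 h0).lt_or_eq with hlt | heq
    · obtain ⟨η, hη, hae⟩ := exists_ae_sub_le_of_esssup_lt hlt
      exact tiltInf_eq_zero hη hae
    · rw [tiltInf_eq_of_ae_nonpos hp (hX.sub_const x) h0]
      simp only [sub_eq_zero, Measure.real, h heq.symm, ENNReal.toReal_zero]
      exact Real.zero_rpow (by positivity)
  obtain ⟨δ, hδ, hc⟩ := tiltInf_continuousAt hp (hX.sub_const x) hzero hε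
  refine ⟨δ, hδ, fun Y hY y hd => ?_⟩
  rw [bufferedProb_eq_tiltInf hp hX, bufferedProb_eq_tiltInf hp hY]
  exact hc _ (hY.sub_const y) hd

lemma bufferedProb_continuousOn (hp : 1 ≤ p) (hX : MemLp X (ENNReal.ofReal p) μ) :
    ContinuousOn (bufferedProb p μ X)
      {x : ℝ | ∫ ω, X ω ∂μ ≤ x ∧ (x : EReal) < esssup μ X} := by
  rintro x ⟨-, hx⟩
  refine ContinuousAt.continuousWithinAt (Metric.continuousAt_iff.2 fun ε hε => ?_)
  obtain ⟨δ, hδ, hc⟩ := bufferedProb_continuousAt (x := x) hp hX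
    (fun h => absurd h hx.ne) hε
  refine ⟨δ, hδ, fun y hy => hc X hX y ?_⟩
  have hp0 : 0 < p := by linarith
  simpa [lpNorm_const, hp0, IsProbabilityMeasure.ne_zero μ, Real.dist_eq, abs_sub_comm] using hy

lemma bufferedProb_quasiconvexOn (hp : 1 ≤ p) (x : ℝ) :
    QuasiconvexOn ℝ {X : Ω → ℝ | MemLp X (ENNReal.ofReal p) μ}
      (fun X => bufferedProb p μ X x) := by
  intro r X hX Y hY s t hs ht hst
  obtain ⟨hX, hXr⟩ := hX
  obtain ⟨hY, hYr⟩ := hY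
  have hX : MemLp X (ENNReal.ofReal p) μ := hX
  have hY : MemLp Y (ENNReal.ofReal p) μ := hY
  have hZ : MemLp (s • X + t • Y) (ENNReal.ofReal p) μ := (hX.const_smul s).add (hY.const_smul t)
  refine ⟨hZ, ?_⟩
  simp only [bufferedProb_eq_tiltInf hp hX, bufferedProb_eq_tiltInf hp hY,
    bufferedProb_eq_tiltInf hp hZ] at hXr hYr ⊢
  refine le_of_forall_pos_le_add fun ε hε => ?_
  obtain ⟨⟨a, ha⟩, haε⟩ := exists_lt_of_ciInf_lt
    (show ⨅ a : Set.Ici (0 : ℝ), tiltNorm p μ (fun ω => X ω - x) a < r + ε from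
      hXr.trans_lt (lt_add_of_pos_right _ hε))
  obtain ⟨⟨b, hb⟩, hbε⟩ := exists_lt_of_ciInf_lt
    (show ⨅ a : Set.Ici (0 : ℝ), tiltNorm p μ (fun ω => Y ω - x) a < r + ε from
      hYr.trans_lt (lt_add_of_pos_right _ hε))
  have ha : 0 ≤ a := ha
  have hb : 0 ≤ b := hb
  simp only at haε hbε
  -- If `a = 0` or `b = 0`, then `r + ε > 1` and the bound is trivial.
  rcases ha.eq_or_lt with rfl | ha
  · rw [tiltNorm_zero hp] at haε
    exact (tiltInf_le_one hp).trans haε.le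
  rcases hb.eq_or_lt with rfl | hb
  · rw [tiltNorm_zero hp] at hbε
    exact (tiltInf_le_one hp).trans hbε.le
  have hD : 0 < s * b + t * a := by
    rcases hs.eq_or_lt with rfl | hs
    · have : t = 1 := by linarith
      simp [this, ha]
    · positivity
  have hw : s * b / (s * b + t * a) + t * a / (s * b + t * a) = 1 := by
    rw [← add_div, div_self hD.ne']
  -- The new parameter is the weighted harmonic mean of `a` and `b`: its reciprocal is `s / a + t /
  -- b`. This makes the new tilt, before positive parts, a convex combination of the two old ones.
  refine (tiltInf_le (a := a * b / (s * b + t * a)) (by positivity)).trans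
    ((tiltNorm_le_of_le (a := a) (b := b) (s := s * b / (s * b + t * a))
      (t := t * a / (s * b + t * a)) hp (by positivity) (by positivity) (hX.sub_const x)
      (hY.sub_const x) fun ω => le_of_eq ?_).trans ?_)
  · simp only [Pi.add_apply, Pi.smul_apply, smul_eq_mul]
    linear_combination -hw + a * b / (s * b + t * a) * x * hst
  · have h1 := mul_le_mul_of_nonneg_left haε.le (show 0 ≤ s * b / (s * b + t * a) by positivity)
    have h2 := mul_le_mul_of_nonneg_left hbε.le (show 0 ≤ t * a / (s * b + t * a) by positivity)
    have h3 := congrArg (· * (r + ε)) hw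
    simp only [add_mul, one_mul] at h3
    linarith

end BufferedProb

/-! ### Comparison across probability spaces and exponents -/

section Comparison

variable {Ω Ω₁ Ω₂ : Type*} [MeasurableSpace Ω] [MeasurableSpace Ω₁] [MeasurableSpace Ω₂]
  {μ : Measure Ω} [IsProbabilityMeasure μ] {μ₁ : Measure Ω₁} [IsProbabilityMeasure μ₁]
  {μ₂ : Measure Ω₂} [IsProbabilityMeasure μ₂] {p x : ℝ}

lemma bufferedProb_le_of_integral_le (hp : 1 ≤ p) {X : Ω → ℝ} {Y : Ω₁ → ℝ}
    (hX : MemLp X (ENNReal.ofReal p) μ) (hY : MemLp Y (ENNReal.ofReal p) μ₁)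
    (h : ∀ a, 0 ≤ a → ∫ ω, max (1 + a * (X ω - x)) 0 ^ p ∂μ ≤
      ∫ ω, max (1 + a * (Y ω - x)) 0 ^ p ∂μ₁) :
    bufferedProb p μ X x ≤ bufferedProb p μ₁ Y x := by
  rw [bufferedProb_eq_tiltInf hp hX, bufferedProb_eq_tiltInf hp hY]
  refine le_tiltInf fun a ha => (tiltInf_le ha).trans ?_
  rw [tiltNorm_eq_integral hp (hX.sub_const x), tiltNorm_eq_integral hp (hY.sub_const x)]
  exact Real.rpow_le_rpow (integral_nonneg fun _ => by positivity) (h a ha) (by positivity)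

lemma measurable_tilt_rpow (a x p : ℝ) :
    Measurable fun y : ℝ => max (1 + a * (y - x)) 0 ^ p := by fun_prop

lemma bufferedProb_congr_identDistrib (hp : 1 ≤ p) {X : Ω → ℝ} {Y : Ω₁ → ℝ}
    (hX : MemLp X (ENNReal.ofReal p) μ) (hY : MemLp Y (ENNReal.ofReal p) μ₁)
    (h : IdentDistrib X Y μ μ₁) : bufferedProb p μ X x = bufferedProb p μ₁ Y x :=
  have key := fun a => (h.comp (measurable_tilt_rpow a x p)).integral_eq
  le_antisymm (bufferedProb_le_of_integral_le hp hX hY fun a _ => (key a).le)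
    (bufferedProb_le_of_integral_le hp hY hX fun a _ => (key a).ge)

lemma bufferedProb_mono_secondOrder (hp : 1 ≤ p) {X : Ω → ℝ} {Y : Ω₁ → ℝ}
    (hX : MemLp X (ENNReal.ofReal p) μ) (hY : MemLp Y (ENNReal.ofReal p) μ₁)
    (h : SecondOrderDominates μ (fun ω => -X ω) μ₁ (fun ω => -Y ω)) :
    bufferedProb p μ X x ≤ bufferedProb p μ₁ Y x := by
  refine bufferedProb_le_of_integral_le hp hX hY fun a ha => ?_
  have hp0 : 0 ≤ p := by linarith
  have hconv : ConvexOn ℝ Set.univ fun y : ℝ => max (1 + a * (-y - x)) 0 ^ p := by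
    refine ⟨convex_univ, fun y _ z _ s t hs ht hst => ?_⟩
    refine le_trans ?_ ((convexOn_rpow hp).2 (le_max_right (1 + a * (-y - x)) 0)
      (le_max_right (1 + a * (-z - x)) 0) hs ht hst)
    refine Real.rpow_le_rpow (le_max_right _ _) (max_le ?_ ?_) hp0
    · have h1 := mul_le_mul_of_nonneg_left (le_max_left (1 + a * (-y - x)) 0) hs
      have h2 := mul_le_mul_of_nonneg_left (le_max_left (1 + a * (-z - x)) 0) ht
      have ht' : t = 1 - s := by linarith
      subst ht'
      simp only [smul_eq_mul] at h1 h2 ⊢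
      linarith
    · simp only [smul_eq_mul]
      positivity
  have hmono : Monotone fun y : ℝ => -(max (1 + a * (-y - x)) 0 ^ p) := fun y z hyz => by
    simp only
    gcongr
  -- As a function of the return `y = -X`, the negated `p`-th power of the tilt is an increasing
  -- concave utility.
  have := h (fun y => -(max (1 + a * (-y - x)) 0 ^ p)) hmono hconv.neg
    (by simpa using (integrable_tilt_rpow hp (hX.sub_const x) a).neg)
    (by simpa using (integrable_tilt_rpow hp (hY.sub_const x) a).neg)
  simpa only [neg_neg, integral_neg, neg_le_neg_iff] using this

/-- At fixed `a` the `p`-th power of the norm is affine in the law, and the power mean inequality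
makes the norm itself concave; an infimum of concave functions is concave. -/
lemma bufferedProb_concave_mixture (hp : 1 ≤ p) {t : ℝ} (ht0 : 0 ≤ t) (ht1 : t ≤ 1) {X : Ω → ℝ}
    {X₁ : Ω₁ → ℝ} {X₂ : Ω₂ → ℝ} (hX : MemLp X (ENNReal.ofReal p) μ)
    (hX₁ : MemLp X₁ (ENNReal.ofReal p) μ₁) (hX₂ : MemLp X₂ (ENNReal.ofReal p) μ₂)
    (h : IsMixture t μ X μ₁ X₁ μ₂ X₂) :
    t * bufferedProb p μ₁ X₁ x + (1 - t) * bufferedProb p μ₂ X₂ x ≤ bufferedProb p μ X x := by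
  have hp0 : 0 < p := by linarith
  have ht1' : 0 ≤ 1 - t := sub_nonneg.2 ht1
  rw [bufferedProb_eq_tiltInf hp hX, bufferedProb_eq_tiltInf hp hX₁,
    bufferedProb_eq_tiltInf hp hX₂]
  refine le_tiltInf fun a ha => ?_
  have h1 := mul_le_mul_of_nonneg_left (tiltInf_le (p := p) (μ := μ₁)
    (Z := fun ω => X₁ ω - x) ha) ht0
  have h2 := mul_le_mul_of_nonneg_left (tiltInf_le (p := p) (μ := μ₂)
    (Z := fun ω => X₂ ω - x) ha) ht1'
  refine (add_le_add h1 h2).trans ?_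
  have hm := measurable_tilt_rpow a x p
  have key : tiltNorm p μ (fun ω => X ω - x) a ^ p =
      t * tiltNorm p μ₁ (fun ω => X₁ ω - x) a ^ p +
        (1 - t) * tiltNorm p μ₂ (fun ω => X₂ ω - x) a ^ p := by
    rw [tiltNorm_rpow hp (hX.sub_const x), tiltNorm_rpow hp (hX₁.sub_const x),
      tiltNorm_rpow hp (hX₂.sub_const x),
      ← integral_map hX.aemeasurable (f := fun y => max (1 + a * (y - x)) 0 ^ p)
        hm.aestronglyMeasurable, h, integral_add_measure, integral_smul_measure,
      integral_smul_measure, integral_map hX₁.aemeasurable hm.aestronglyMeasurable,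
      integral_map hX₂.aemeasurable hm.aestronglyMeasurable, ENNReal.toReal_ofReal ht0,
      ENNReal.toReal_ofReal ht1', smul_eq_mul, smul_eq_mul]
    · exact ((integrable_map_measure hm.aestronglyMeasurable hX₁.aemeasurable).2
        (integrable_tilt_rpow hp (hX₁.sub_const x) a)).smul_measure ENNReal.ofReal_ne_top
    · exact ((integrable_map_measure hm.aestronglyMeasurable hX₂.aemeasurable).2
        (integrable_tilt_rpow hp (hX₂.sub_const x) a)).smul_measure ENNReal.ofReal_ne_top
  refine (Real.rpow_le_rpow_iff ?_ tiltNorm_nonneg hp0).1 ?_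
  · exact add_nonneg (mul_nonneg ht0 tiltNorm_nonneg) (mul_nonneg ht1' tiltNorm_nonneg)
  · rw [key]
    exact (convexOn_rpow hp).2 (Set.mem_Ici.2 tiltNorm_nonneg) (Set.mem_Ici.2 tiltNorm_nonneg)
      ht0 ht1' (by ring)

/-- On a probability space `L^p` norms increase with the exponent, for each fixed `a`. -/
lemma bufferedProb_mono_exponent {q : ℝ} (hp : 1 ≤ p) (hpq : p ≤ q) {X : Ω → ℝ}
    (hX : MemLp X (ENNReal.ofReal q) μ) : bufferedProb p μ X x ≤ bufferedProb q μ X x := by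
  have hpq' := ENNReal.ofReal_le_ofReal hpq
  rw [bufferedProb_eq_tiltInf hp (hX.mono_exponent hpq'),
    bufferedProb_eq_tiltInf (hp.trans hpq) hX]
  refine le_tiltInf fun a ha => (tiltInf_le ha).trans ?_
  have hZ := (hX.sub_const x).tilt a
  rw [tiltNorm, tiltNorm, ← toReal_eLpNorm hZ.aestronglyMeasurable,
    ← toReal_eLpNorm hZ.aestronglyMeasurable]
  exact ENNReal.toReal_mono hZ.eLpNorm_ne_top
    (eLpNorm_le_eLpNorm_of_exponent_le hpq' hZ.aestronglyMeasurable)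

end Comparison

theorem mainTheorem4 {Ω Ω₁ Ω₂ : Type*}
    [MeasurableSpace Ω] [MeasurableSpace Ω₁] [MeasurableSpace Ω₂]
    (μ : Measure Ω) [IsProbabilityMeasure μ]
    (μ₁ : Measure Ω₁) [IsProbabilityMeasure μ₁]
    (μ₂ : Measure Ω₂) [IsProbabilityMeasure μ₂] :
    -- the map in `x`
    (∀ p : ℝ, 1 ≤ p → ∀ X : Ω → ℝ, MemLp X (ENNReal.ofReal p) μ →
      Antitone (fun x : ℝ => bufferedProb p μ X x) ∧
      ContinuousOn (fun x : ℝ => bufferedProb p μ X x)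
        {x : ℝ | ∫ ω, X ω ∂μ ≤ x ∧ (x : EReal) < esssup μ X} ∧
      StrictAntiOn (fun x : ℝ => bufferedProb p μ X x)
        {x : ℝ | ∫ ω, X ω ∂μ ≤ x ∧ (x : EReal) < esssup μ X}) ∧
    -- the map in `X`
    (∀ p : ℝ, 1 ≤ p → ∀ x : ℝ,
      -- quasi-convexity
      QuasiconvexOn ℝ {X : Ω → ℝ | MemLp X (ENNReal.ofReal p) μ}
        (fun X => bufferedProb p μ X x) ∧
      -- law invariance
      (∀ (X : Ω → ℝ) (Y : Ω₁ → ℝ), MemLp X (ENNReal.ofReal p) μ →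
        MemLp Y (ENNReal.ofReal p) μ₁ → IdentDistrib X Y μ μ₁ →
        bufferedProb p μ X x = bufferedProb p μ₁ Y x) ∧
      -- second order monotonicity (`X` and `Y` are losses, `-X` and `-Y` are returns)
      (∀ (X : Ω → ℝ) (Y : Ω₁ → ℝ), MemLp X (ENNReal.ofReal p) μ →
        MemLp Y (ENNReal.ofReal p) μ₁ →
        SecondOrderDominates μ (fun ω => - X ω) μ₁ (fun ω => - Y ω) →
        bufferedProb p μ X x ≤ bufferedProb p μ₁ Y x) ∧
      -- continuity in the `L^p` norm, unless `x` is the essential supremum and an atom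
      (∀ X : Ω → ℝ, MemLp X (ENNReal.ofReal p) μ →
        ((x : EReal) = esssup μ X → μ {ω | X ω = x} = 0) →
        ∀ ε : ℝ, 0 < ε → ∃ δ : ℝ, 0 < δ ∧
          ∀ Y : Ω → ℝ, MemLp Y (ENNReal.ofReal p) μ →
            lpNorm (fun ω => Y ω - X ω) (ENNReal.ofReal p) μ < δ →
            |bufferedProb p μ Y x - bufferedProb p μ X x| < ε) ∧
      -- concavity with respect to mixtures of distributions
      (∀ (t : ℝ) (X : Ω → ℝ) (X₁ : Ω₁ → ℝ) (X₂ : Ω₂ → ℝ), 0 ≤ t → t ≤ 1 →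
        MemLp X (ENNReal.ofReal p) μ → MemLp X₁ (ENNReal.ofReal p) μ₁ →
        MemLp X₂ (ENNReal.ofReal p) μ₂ → IsMixture t μ X μ₁ X₁ μ₂ X₂ →
        t * bufferedProb p μ₁ X₁ x + (1 - t) * bufferedProb p μ₂ X₂ x ≤
          bufferedProb p μ X x)) ∧
    -- the map in `p`
    (∀ (X : Ω → ℝ) (x : ℝ),
      MonotoneOn (fun p : ℝ => bufferedProb p μ X x)
        {p : ℝ | 1 ≤ p ∧ MemLp X (ENNReal.ofReal p) μ}) := by
  refine ⟨fun p hp X hX => ⟨bufferedProb_antitone hp hX, bufferedProb_continuousOn hp hX,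
    bufferedProb_strictAntiOn hp hX⟩, fun p hp x => ⟨bufferedProb_quasiconvexOn hp x,
    fun X Y hX hY h => bufferedProb_congr_identDistrib hp hX hY h,
    fun X Y hX hY h => bufferedProb_mono_secondOrder hp hX hY h, fun X hX h ε hε => ?_,
    fun t X X₁ X₂ ht0 ht1 hX hX₁ hX₂ h =>
      bufferedProb_concave_mixture hp ht0 ht1 hX hX₁ hX₂ h⟩,
    fun X x p hp q hq hpq => bufferedProb_mono_exponent hp.1 hpq hq.2⟩
  obtain ⟨δ, hδ, hc⟩ := bufferedProb_continuousAt hp hX h hε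
  exact ⟨δ, hδ, fun Y hY hd => hc Y hY x (by simpa using hd)⟩
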